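/- Let there be $n$ items $d^1,\dots,d^n$ and a family $\mathcal G$ of (possibly overlapping) groups of items. Let $f$ be a fixed relevance model assigning to each query $q$ and item $d$ a score $f(q,d)\in[0,1]$. For each query $q$ and group $g$ let $\sigma_{q,g}$ be a deterministic ranking of the items of $g$ in non-increasing order of the scores $f(q,\cdot)$ (ties broken arbitrarily, measurably in $q$), so that $\sigma_{q,g}(j)$ is the index of the item of $g$ at position $j$. Let $t_g^{\max}$ be at most the number of items of $g$, and write $[k]=\{1,\dots,k\}$. Let $P_{Q,\mathbf R}$ be any distribution of a query and a relevance vector $\mathbf r\in\{0,1\}^n$, and set $$U_g(t)=\mathbb E_{(q,\mathbf r)\sim P_{Q,\mathbf R}}\Big[\sum_{j\in[t]} r^{\sigma_{q,g}(j)}\Big].$$ Let $m>1$. For $i\in[m]$ let the triples $(Q_i,\mathbf R_i,\mathbf O_i)$ be independent, where $(Q_i,\mathbf R_i)\sim P_{Q,\mathbf R}$ and, given $(Q_i,\mathbf R_i)=(q,\mathbf r)$, the observation vector $\mathbf O_i\in\{0,1\}^n$ has the conditional law $P^{\pi_0}_{\mathbf O\mid q,\mathbf r}$ determined by a fixed logging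 policy $\pi_0$. The user feedback is $C_i^j=O_i^jR_i^j$. The propensities are $p^j(q,\mathbf r)=P^{\pi_0}_{\mathbf O\mid q,\mathbf r}(O^j=1)$, and $p_i^j=p^j(Q_i,\mathbf R_i)$. Assume that the propensities are bounded away from zero: there is $\gamma>0$ such that for every $g\in\mathcal G$ and $j\in[t_g^{\max}]$, $p^{\sigma_{q,g}(j)}(q,\mathbf r)>\gamma$ for $P_{Q,\mathbf R}$-almost every $(q,\mathbf r)$. For $\lambda>0$ put $$Z_i^{g,t}=\sum_{j\in[t]}\min\Big(\lambda,\frac1{p_i^{\sigma_{Q_i,g}(j)}}\Big)C_i^{\sigma_{Q_i,g}(j)},\qquad \hat U^{\mathrm{CIPW}}_{g,\lambda}(t)=\frac1m\sum_{i\in[m]}Z_i^{g,t},$$ $$V_m(\mathbf Z^{g,t})=\frac1{m(m-1)}\sum_{1\le i<j\le m}\big(Z_i^{g,t}-Z_j^{g,t}\big)^2 .$$ Then for every $\lambda>0$, $g\in\mathcal G$, $t\in[t_g^{\max}-1]$ and $\alpha\in(0,1)$, with probability at least $1-\alpha$, $$U_g(t)\le \hat U^{\mathrm{CIPW}}_{g,\lambda}(t)+\sqrt{\frac{2V_m(\mathbf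 Z^{g,t})\ln(4/\alpha)}{m}}+\frac{7t\lambda\ln(4/\alpha)}{3(m-1)}+t\sqrt{\frac{\ln(2/\alpha)}{2m}}+\frac1m\sum_{i\in[m]}\sum_{j\in[t]}\max\big(0,1-\lambda p_i^{\sigma_{Q_i,g}(j)}\big).$$ -/

import Mathlib

open MeasureTheory ProbabilityTheory

namespace FairFirstStage

/-- The real number `0` or `1` encoded by a binary outcome (a relevance or an observation). -/
def bit (b : Bool) : ℝ := if b then 1 else 0

/-- `σ q g` ranks the items of every group `g` for the query `q` by the scores `f q (d j)`:
the positions `1, …, |g|` enumerate the items of the group, each exactly once, in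
non-increasing order of the score. Ties may be broken in any deterministic way.
The values of `σ q g` at other positions are irrelevant. -/
structure IsGroupRanking {Query D G : Type*} {n : ℕ} (d : Fin n → D)
    (f : Query → D → unitInterval) (group : G → Finset (Fin n))
    (σ : Query → G → ℕ → Fin n) : Prop where
  bijOn : ∀ q g, Set.BijOn (σ q g) (Set.Icc 1 (group g).card) (group g : Set (Fin n))
  antitoneOn : ∀ q g, AntitoneOn (fun k => f q (d (σ q g k))) (Set.Icc 1 (group g).card)

section

variable {Query G : Type*} [MeasurableSpace Query] {n : ℕ}

/-- The expected number `U_g(t)` of relevant items among the `t` top-ranked items of group `g`,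
where the query and the relevance vector have the joint distribution `P`. -/
noncomputable def expectedRelevant (P : Measure (Query × (Fin n → Bool)))
    (σ : Query → G → ℕ → Fin n) (g : G) (t : ℕ) : ℝ :=
  ∫ z, ∑ k ∈ Finset.Icc 1 t, bit (z.2 (σ z.1 g k)) ∂P

/-- The propensity of item `j` given the query `q` and the relevance vector `r`: the conditional
probability that the user observes item `j`. The kernel `obs` is the conditional law of the
observation vector given query and relevance vector under the logging policy. -/
noncomputable def propensity (obs : Kernel (Query × (Fin n → Bool)) (Fin n → Bool))
    (q : Query) (r : Fin n → Bool) (j : Fin n) : ℝ :=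
  (obs (q, r)).real {o | o j = true}

/-- The user feedback on item `j`: the product of observation and relevance. -/
def feedback (r o : Fin n → Bool) (j : Fin n) : ℝ := bit (o j) * bit (r j)

/-- The clipped inverse propensity weighted estimate from one request, with query `q`,
relevance vector `r` and observation vector `o`. -/
noncomputable def requestCIPW (obs : Kernel (Query × (Fin n → Bool)) (Fin n → Bool))
    (σ : Query → G → ℕ → Fin n) (lam : ℝ) (g : G) (t : ℕ)
    (q : Query) (r o : Fin n → Bool) : ℝ :=
  ∑ k ∈ Finset.Icc 1 t,
    min lam (1 / propensity obs q r (σ q g k)) * feedback r o (σ q g k)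

/-- The sample variance `1 / (m (m - 1)) * ∑_{i < j} (Z_i - Z_j)²`. -/
noncomputable def sampleVariance {m : ℕ} (Z : Fin m → ℝ) : ℝ :=
  1 / ((m : ℝ) * ((m : ℝ) - 1)) * ∑ i, ∑ j ∈ Finset.Ioi i, (Z i - Z j) ^ 2

/-- The CIPW estimate of `U_g(t)` from `m` requests with queries `q i`, relevance vectors `r i`
and observation vectors `o i`. -/
noncomputable def cipw (obs : Kernel (Query × (Fin n → Bool)) (Fin n → Bool))
    (σ : Query → G → ℕ → Fin n) (lam : ℝ) (g : G) (t : ℕ) {m : ℕ}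
    (q : Fin m → Query) (r o : Fin m → Fin n → Bool) : ℝ :=
  1 / (m : ℝ) * ∑ i, requestCIPW obs σ lam g t (q i) (r i) (o i)

/-- The empirical upper confidence bound on `U_g(t)` at level `α`. -/
noncomputable def upperBound (obs : Kernel (Query × (Fin n → Bool)) (Fin n → Bool))
    (σ : Query → G → ℕ → Fin n) (lam : ℝ) (g : G) (t : ℕ) (α : ℝ) {m : ℕ}
    (q : Fin m → Query) (r o : Fin m → Fin n → Bool) : ℝ :=
  cipw obs σ lam g t q r o
    + √(2 * sampleVariance (fun i => requestCIPW obs σ lam g t (q i) (r i) (o i))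
          * Real.log (4 / α) / m)
    + 7 * t * lam * Real.log (4 / α) / (3 * ((m : ℝ) - 1))
    + t * √(Real.log (2 / α) / (2 * m))
    + 1 / (m : ℝ) * ∑ i, ∑ k ∈ Finset.Icc 1 t,
        max 0 (1 - lam * propensity obs (q i) (r i) (σ (q i) g k))

end

end FairFirstStage

namespace FairFirstStage

/-! Taking the expectation over the observations given `(q, r)` turns each summand of the clipped
estimate into `min λ (1/p) * p * r`. Since `r ≤ min λ (1/p) * p * r + max 0 (1 - λ p)`, integrating
gives `U_g(t) ≤ E Z + E B`, where `B` is the clipping bias of one request (`expectedRelevant_le`).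
Both means are then bounded by their empirical counterparts, each with failure probability `α / 2`:
`E Z` by the empirical Bernstein inequality, as `Z ∈ [0, tλ]`, and `E B` by Hoeffding's, as `B ∈ [0,
t]`.

The empirical Bernstein inequality combines Bernstein's inequality, which involves the true variance
`v`, with a lower tail bound for the sample variance `V`. For the latter, `V` is an average over
permutations of means of `⌊m/2⌋` independent terms `(x - y)² / 2`, each of expectation `v` and in
`[0, 1/2]`. Jensen's inequality for `exp` reduces the moment generating function of the average to
that of a single such mean. -/

/-! ### Elementary bounds on the exponential -/

/-- Multiply by `exp y ≥ 1 + y + y²/2` and use `(1 - y + y²/2)(1 + y + y²/2) = 1 + y⁴/4 ≥ 1`. -/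
lemma exp_neg_le_quadratic {y : ℝ} (hy : 0 ≤ y) : Real.exp (-y) ≤ 1 - y + y ^ 2 / 2 := by
  have h := Real.quadratic_le_exp_of_nonneg hy
  have hq : 0 < 1 - y + y ^ 2 / 2 := by nlinarith [sq_nonneg (y - 1)]
  have hmul : Real.exp (-y) * Real.exp y = 1 := by rw [← Real.exp_add]; simp
  have hpos := Real.exp_pos (-y)
  nlinarith [mul_le_mul_of_nonneg_left h (mul_nonneg hpos.le hq.le), sq_nonneg (y ^ 2)]

/-- This is `exp x ≤ 1 + x + x² / (2 (1 - x/3))` with the denominator cleared, which makes it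
meaningful for every `x ≥ 0`. After multiplication by `exp (-x)` it says `F 0 ≤ F x` for the
function `F` below, whose derivative is nonnegative because `exp x ≥ 1 + x + x²/2`. -/
lemma exp_mul_sub_le {x : ℝ} (hx : 0 ≤ x) : Real.exp x * (6 - 2 * x) ≤ 6 + 4 * x + x ^ 2 := by
  set F : ℝ → ℝ := fun x => Real.exp (-x) * (6 + 4 * x + x ^ 2) + 2 * x
  have hd : ∀ y, HasDerivAt F (2 - Real.exp (-y) * (2 + 2 * y + y ^ 2)) y := by
    intro y
    have h1 : HasDerivAt (fun x : ℝ => Real.exp (-x)) (Real.exp (-y) * (-1)) y :=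
      (hasDerivAt_neg y).exp
    have h2 : HasDerivAt (fun x : ℝ => 6 + 4 * x + x ^ 2) (4 + 2 * y) y := by
      have := (((hasDerivAt_id y).const_mul 4).const_add 6).add ((hasDerivAt_id y).pow 2)
      convert! this using 1
      simp
    have h3 := (h1.mul h2).add ((hasDerivAt_id y).const_mul 2)
    convert! h3 using 1
    ring
  have hmono : MonotoneOn F (Set.Ici 0) := by
    refine monotoneOn_of_deriv_nonneg (convex_Ici 0)
      (fun y _ => (hd y).continuousAt.continuousWithinAt)
      (fun y _ => (hd y).differentiableAt.differentiableWithinAt) fun y hy => ?_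
    rw [interior_Ici] at hy
    rw [(hd y).deriv]
    have h := Real.quadratic_le_exp_of_nonneg (le_of_lt hy)
    have hmul : Real.exp (-y) * Real.exp y = 1 := by rw [← Real.exp_add]; simp
    nlinarith [mul_le_mul_of_nonneg_left h (Real.exp_pos (-y)).le]
  have h := hmono (Set.mem_Ici.2 le_rfl) (Set.mem_Ici.2 hx) hx
  simp only [F, neg_zero, Real.exp_zero] at h
  have hmul : Real.exp x * Real.exp (-x) = 1 := by rw [← Real.exp_add]; simp
  have h' := mul_le_mul_of_nonneg_left h (Real.exp_pos x).le
  have e : Real.exp x * (Real.exp (-x) * (6 + 4 * x + x ^ 2) + 2 * x)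
    = Real.exp x * Real.exp (-x) * (6 + 4 * x + x ^ 2) + Real.exp x * (2 * x) := by ring
  rw [e, hmul] at h'
  linarith

lemma exp_le_of_le {x s : ℝ} (hs : 0 ≤ s) (hs3 : s < 3) (hx : x ≤ s) :
    Real.exp x ≤ 1 + x + x ^ 2 / (2 * (1 - s / 3)) := by
  have hden : 0 < 2 * (1 - s / 3) := by linarith
  rcases le_total x 0 with h0 | h0
  · have h := exp_neg_le_quadratic (y := -x) (by linarith)
    rw [neg_neg] at h
    have : x ^ 2 / 2 ≤ x ^ 2 / (2 * (1 - s / 3)) :=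
      div_le_div_of_nonneg_left (sq_nonneg x) hden (by linarith)
    nlinarith
  · have h := exp_mul_sub_le h0
    have hdx : 0 < 2 * (1 - x / 3) := by linarith
    have h1 : Real.exp x ≤ 1 + x + x ^ 2 / (2 * (1 - x / 3)) := by
      have : 1 + x + x ^ 2 / (2 * (1 - x / 3))
          = ((1 + x) * (2 * (1 - x / 3)) + x ^ 2) / (2 * (1 - x / 3)) := by
        rw [add_div, mul_div_cancel_right₀ _ hdx.ne']
      rw [this, le_div_iff₀ hdx]
      nlinarith
    have : x ^ 2 / (2 * (1 - x / 3)) ≤ x ^ 2 / (2 * (1 - s / 3)) :=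
      div_le_div_of_nonneg_left (sq_nonneg x) hden (by linarith)
    linarith

/-! ### Bernstein's inequality -/

section

variable {Ω : Type*} [MeasurableSpace Ω] {μ : Measure Ω} [IsProbabilityMeasure μ]

lemma integrable_of_bounded {f : Ω → ℝ} (hf : AEMeasurable f μ) {a b : ℝ}
    (hb : ∀ ω, f ω ∈ Set.Icc a b) : Integrable f μ :=
  Integrable.of_mem_Icc a b hf (Filter.Eventually.of_forall hb)

/-- Bernstein's bound on the moment generating function of a centred variable bounded above
by `1`. -/
lemma mgf_le_bernstein {Y : Ω → ℝ} (hY : AEMeasurable Y μ) (hb : ∀ ω, Y ω ∈ Set.Icc (-1 : ℝ) 1)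
    (h0 : ∫ ω, Y ω ∂μ = 0) {s : ℝ} (hs : 0 ≤ s) (hs3 : s < 3) :
    mgf Y μ s ≤ Real.exp (s ^ 2 * (∫ ω, Y ω ^ 2 ∂μ) / (2 * (1 - s / 3))) := by
  have hYi : Integrable Y μ := integrable_of_bounded hY hb
  have hY2 : Integrable (fun ω => Y ω ^ 2) μ := by
    refine integrable_of_bounded (a := 0) (b := 1) (hY.pow_const 2) fun ω => ⟨sq_nonneg _, ?_⟩
    have := hb ω
    nlinarith [this.1, this.2]
  have h1 : mgf Y μ s
      ≤ ∫ ω, (1 + s * Y ω + s ^ 2 / (2 * (1 - s / 3)) * Y ω ^ 2) ∂μ := by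
    refine integral_mono (integrable_exp_mul_of_mem_Icc hY (Filter.Eventually.of_forall hb))
      (((integrable_const _).add (hYi.const_mul s)).add (hY2.const_mul _)) fun ω => ?_
    have h := exp_le_of_le hs hs3 (x := s * Y ω) (by nlinarith [(hb ω).2])
    refine h.trans (le_of_eq ?_)
    ring
  have h2 : ∫ ω, (1 + s * Y ω + s ^ 2 / (2 * (1 - s / 3)) * Y ω ^ 2) ∂μ
      = s ^ 2 * (∫ ω, Y ω ^ 2 ∂μ) / (2 * (1 - s / 3)) + 1 := by
    have e1 : ∫ ω, (1 + s * Y ω + s ^ 2 / (2 * (1 - s / 3)) * Y ω ^ 2) ∂μ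
        = ∫ ω, (1 + s * Y ω) ∂μ + ∫ ω, s ^ 2 / (2 * (1 - s / 3)) * Y ω ^ 2 ∂μ :=
      integral_add ((integrable_const _).add (hYi.const_mul s)) (hY2.const_mul _)
    rw [e1, integral_add (integrable_const _) (hYi.const_mul s), integral_const_mul,
      integral_const_mul, h0]
    simp
    ring
  rw [h2] at h1
  exact h1.trans (Real.add_one_le_exp _)

/-- Bernstein's inequality for the lower tail of the mean of independent variables in `[0, 1]`
with common mean and variance; `a` is a free parameter. -/
lemma bernstein_lower_tail {m : ℕ} (hm : 0 < m) {X : Fin m → Ω → ℝ} (hX : ∀ i, AEMeasurable (X i) μ)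
    (hindep : iIndepFun X μ) (hb : ∀ i ω, X i ω ∈ Set.Icc (0 : ℝ) 1) {c v : ℝ}
    (hc : ∀ i, ∫ ω, X i ω ∂μ = c) (hv : ∀ i, ∫ ω, (X i ω - c) ^ 2 ∂μ = v) {L a : ℝ} (ha : 0 < a) :
    μ.real {ω | v * a / 2 + L / (m * a) + L / (3 * m) ≤ c - 1 / (m : ℝ) * ∑ i, X i ω}
      ≤ Real.exp (-L) := by
  have hm' : (0 : ℝ) < m := by exact_mod_cast hm
  -- With this Chernoff parameter `1 - s/3 = 1 / (1 + a/3)`, and the exponent `-s m u + m s² v / (2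
  -- (1 - s/3))` equals `-L` exactly.
  set s : ℝ := a / (1 + a / 3) with hs
  have ha3 : 0 < 1 + a / 3 := by positivity
  have hs0 : 0 ≤ s := by positivity
  have hs3 : s < 3 := by rw [hs, div_lt_iff₀ ha3]; linarith
  have hc01 : c ∈ Set.Icc (0 : ℝ) 1 := by
    rw [← hc ⟨0, hm⟩]
    refine ⟨integral_nonneg fun ω => (hb _ ω).1, ?_⟩
    calc ∫ ω, X ⟨0, hm⟩ ω ∂μ ≤ ∫ _, (1 : ℝ) ∂μ :=
          integral_mono (integrable_of_bounded (hX _) (hb _)) (integrable_const _)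
            fun ω => (hb _ ω).2
      _ = 1 := by simp
  set Y : Fin m → Ω → ℝ := fun i ω => c - X i ω with hYdef
  have hYm : ∀ i, AEMeasurable (Y i) μ := fun i => (hX i).const_sub c
  have hYb : ∀ i ω, Y i ω ∈ Set.Icc (-1 : ℝ) 1 := fun i ω =>
    ⟨by linarith [(hb i ω).2, hc01.1], by linarith [(hb i ω).1, hc01.2]⟩
  have hYindep : iIndepFun Y μ :=
    hindep.comp (fun _ x => c - x) fun _ => measurable_const.sub measurable_id
  have hmgf : ∀ i, mgf (Y i) μ s ≤ Real.exp (s ^ 2 * v / (2 * (1 - s / 3))) := by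
    intro i
    have h := mgf_le_bernstein (hYm i) (hYb i) (by
      rw [integral_sub (integrable_const _) (integrable_of_bounded (hX i) (hb i)), hc i]
      simp) hs0 hs3
    have e : ∫ ω, Y i ω ^ 2 ∂μ = v := by
      rw [← hv i]
      congr 1 with ω
      simp only [hYdef]
      ring
    rwa [e] at h
  have hsum : mgf (∑ i, Y i) μ s ≤ Real.exp (m * (s ^ 2 * v / (2 * (1 - s / 3)))) := by
    rw [hYindep.mgf_sum₀ hYm, Real.exp_nat_mul]
    refine (Finset.prod_le_prod (fun i _ => mgf_nonneg) fun i _ => hmgf i).trans ?_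
    simp
  set u := v * a / 2 + L / (m * a) + L / (3 * m) with hu
  have hint : Integrable (fun ω => Real.exp (s * (∑ i, Y i) ω)) μ :=
    integrable_exp_mul_of_mem_Icc (a := ∑ _ : Fin m, (-1 : ℝ)) (b := ∑ _ : Fin m, (1 : ℝ))
      (Finset.aemeasurable_sum _ fun i _ => hYm i) (Filter.Eventually.of_forall fun ω => by
        rw [Finset.sum_apply]
        exact ⟨Finset.sum_le_sum fun i _ => (hYb i ω).1, Finset.sum_le_sum fun i _ => (hYb i ω).2⟩)
  have hch := measure_ge_le_exp_mul_mgf (μ := μ) (X := ∑ i, Y i) (m * u) hs0 hint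
  have hset : {ω | u ≤ c - 1 / (m : ℝ) * ∑ i, X i ω} = {ω | m * u ≤ (∑ i, Y i) ω} := by
    ext ω
    simp only [Set.mem_ofPred_eq, Finset.sum_apply, hYdef, Finset.sum_sub_distrib,
      Finset.sum_const, Finset.card_univ, Fintype.card_fin, nsmul_eq_mul]
    have : (m : ℝ) * c - ∑ i, X i ω = m * (c - 1 / (m : ℝ) * ∑ i, X i ω) := by
      field_simp
    rw [this]
    exact (mul_le_mul_iff_right₀ hm').symm
  rw [hset]
  refine hch.trans ((mul_le_mul_of_nonneg_left hsum (Real.exp_pos _).le).trans ?_)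
  rw [← Real.exp_add, Real.exp_le_exp]
  refine le_of_eq ?_
  have h1 : 1 - s / 3 = 1 / (1 + a / 3) := by rw [hs]; field_simp; ring
  rw [h1, hu, hs]
  field_simp
  ring

end

/-! ### The sample variance as an average over permutations -/

lemma exists_perm_apply_pair {ι : Type*} [DecidableEq ι] {a b a' b' : ι} (hab : a ≠ b)
    (hab' : a' ≠ b') : ∃ τ : Equiv.Perm ι, τ a = a' ∧ τ b = b' := by
  refine ⟨Equiv.swap (Equiv.swap a a' b) b' * Equiv.swap a a', ?_, ?_⟩
  · rw [Equiv.Perm.mul_apply, Equiv.swap_apply_left]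
    refine Equiv.swap_apply_of_ne_of_ne (fun h => hab ?_) hab'
    exact (Equiv.swap a a').injective ((Equiv.swap_apply_left a a').trans h)
  · rw [Equiv.Perm.mul_apply, Equiv.swap_apply_left]

/-- Averaging a function of two distinct positions over all permutations averages it over all
pairs. -/
lemma sum_perm_pair {m : ℕ} (F : Fin m → Fin m → ℝ) (hF : ∀ i, F i i = 0) {a b : Fin m}
    (hab : a ≠ b) :
    ((m : ℝ) * (m - 1)) * ∑ π : Equiv.Perm (Fin m), F (π a) (π b)
      = (Nat.factorial m : ℝ) * ∑ i, ∑ j, F i j := by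
  have hinv : ∀ p ∈ (Finset.univ : Finset (Fin m)).offDiag,
      ∑ π : Equiv.Perm (Fin m), F (π p.1) (π p.2)
        = ∑ π : Equiv.Perm (Fin m), F (π a) (π b) := by
    intro p hp
    obtain ⟨τ, h1, h2⟩ := exists_perm_apply_pair hab (Finset.mem_offDiag.1 hp).2.2
    -- Right multiplication by `τ` carries the pair `(a, b)` to `p`, so all `m (m - 1)` ordered
    -- pairs of distinct positions give the same sum over permutations.
    rw [← Equiv.sum_comp (Equiv.mulRight τ) (fun π : Equiv.Perm (Fin m) => F (π a) (π b))]
    simp [h1, h2]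
  have hcard : (((Finset.univ : Finset (Fin m)).offDiag.card : ℕ) : ℝ) = (m : ℝ) * (m - 1) := by
    rw [Finset.offDiag_card, Finset.card_univ, Fintype.card_fin, Nat.cast_sub (Nat.le_mul_self m)]
    push_cast
    ring
  have hoff : ∀ H : Fin m → Fin m → ℝ, (∀ i, H i i = 0) →
      ∑ p ∈ (Finset.univ : Finset (Fin m)).offDiag, H p.1 p.2 = ∑ i, ∑ j, H i j := by
    intro H hH
    rw [← Fintype.sum_prod_type' H]
    refine Finset.sum_subset (Finset.subset_univ _) fun p _ hp => ?_
    have : p.1 = p.2 := by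
      by_contra h
      exact hp (Finset.mem_offDiag.2 ⟨Finset.mem_univ _, Finset.mem_univ _, h⟩)
    rw [this, hH]
  rw [← hcard, ← nsmul_eq_mul, ← Finset.sum_const, ← Finset.sum_congr rfl hinv, Finset.sum_comm]
  have : ∀ π : Equiv.Perm (Fin m),
      ∑ p ∈ (Finset.univ : Finset (Fin m)).offDiag, F (π p.1) (π p.2) = ∑ i, ∑ j, F i j := by
    intro π
    rw [hoff (fun i j => F (π i) (π j)) fun i => hF _,
      Equiv.sum_comp π (fun i => ∑ j, F i (π j))]
    exact Finset.sum_congr rfl fun i _ => Equiv.sum_comp π (F i)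
  rw [Finset.sum_congr rfl fun π _ => this π, Finset.sum_const, Finset.card_univ,
    Fintype.card_perm, Fintype.card_fin, nsmul_eq_mul]

lemma sum_sum_Ioi_of_symm {m : ℕ} (F : Fin m → Fin m → ℝ) (hF : ∀ i, F i i = 0)
    (hs : ∀ i j, F i j = F j i) : ∑ i, ∑ j, F i j = 2 * ∑ i, ∑ j ∈ Finset.Ioi i, F i j := by
  have h1 : ∀ i, ∑ j ∈ Finset.Ioi i, F i j = ∑ j, if i < j then F i j else 0 := by
    intro i
    rw [← Finset.sum_filter]
    congr 1
    ext j
    simp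
  have h2 : ∑ i, ∑ j, (if i < j then F i j else 0) = ∑ i, ∑ j, if j < i then F i j else 0 := by
    rw [Finset.sum_comm]
    refine Finset.sum_congr rfl fun i _ => Finset.sum_congr rfl fun j _ => ?_
    rw [hs]
  rw [two_mul, Finset.sum_congr rfl fun i _ => h1 i]
  nth_rewrite 2 [h2]
  rw [← Finset.sum_add_distrib]
  refine Finset.sum_congr rfl fun i _ => ?_
  rw [← Finset.sum_add_distrib]
  refine Finset.sum_congr rfl fun j _ => ?_
  rcases lt_trichotomy i j with h | h | h
  · simp [h, h.not_gt]
  · simp [h, hF]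
  · simp [h, h.not_gt]

/-- The sample variance is the average over all permutations of `(Z (π a) - Z (π b)) ^ 2 / 2`. -/
lemma sampleVariance_eq_perm {m : ℕ} (Z : Fin m → ℝ) {a b : Fin m} (hab : a ≠ b) :
    sampleVariance Z = (Nat.factorial m : ℝ)⁻¹ *
      ∑ π : Equiv.Perm (Fin m), (Z (π a) - Z (π b)) ^ 2 / 2 := by
  have hm : 1 < m := by
    by_contra h
    exact hab (Fin.ext (by have := a.2; have := b.2; omega))
  have hm' : (1 : ℝ) < m := by exact_mod_cast hm
  have h1 := sum_perm_pair (fun i j => (Z i - Z j) ^ 2 / 2) (by simp) hab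
  have h2 := sum_sum_Ioi_of_symm (fun i j => (Z i - Z j) ^ 2 / 2) (by simp)
    (fun i j => by ring)
  have h3 : ∑ i, ∑ j ∈ Finset.Ioi i, (Z i - Z j) ^ 2 / 2
      = (∑ i, ∑ j ∈ Finset.Ioi i, (Z i - Z j) ^ 2) / 2 := by
    simp only [Finset.sum_div]
  rw [h2, h3] at h1
  have hf : (Nat.factorial m : ℝ) ≠ 0 := by exact_mod_cast Nat.factorial_ne_zero m
  have hmm : (m : ℝ) * (m - 1) ≠ 0 := mul_ne_zero (by linarith) (by linarith)
  rw [sampleVariance, one_div, inv_mul_eq_iff_eq_mul₀ hmm]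
  rw [← mul_left_cancel_iff_of_pos (show (0 : ℝ) < Nat.factorial m by positivity)]
  rw [show ∀ x y z : ℝ, x * (y * (x⁻¹ * z)) = x * x⁻¹ * (y * z) by intros; ring,
    mul_inv_cancel₀ hf, one_mul, h1]
  ring

lemma sampleVariance_nonneg {m : ℕ} (hm : 1 < m) (Z : Fin m → ℝ) : 0 ≤ sampleVariance Z := by
  have hm' : (1 : ℝ) < m := by exact_mod_cast hm
  have : (0 : ℝ) < m - 1 := by linarith
  unfold sampleVariance
  positivity

lemma sampleVariance_div {m : ℕ} (Z : Fin m → ℝ) (M : ℝ) :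
    sampleVariance (fun i => Z i / M) = sampleVariance Z / M ^ 2 := by
  simp only [sampleVariance, ← sub_div, div_pow, ← Finset.sum_div]
  ring

/-! ### Lower tail of the sample variance -/

section

variable {Ω : Type*} [MeasurableSpace Ω] {μ : Measure Ω}

lemma indepFun_of_dependsOn {ι : Type*} [Fintype ι] [DecidableEq ι] {X : ι → Ω → ℝ}
    (hindep : iIndepFun X μ) (hX : ∀ i, AEMeasurable (X i) μ) {S T : Finset ι}
    (hST : Disjoint S T) {φ ψ : (ι → ℝ) → ℝ} (hφ : Measurable φ) (hψ : Measurable ψ)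
    (hφS : DependsOn φ (S : Set ι)) (hψT : DependsOn ψ (T : Set ι)) :
    IndepFun (fun ω => φ fun i => X i ω) (fun ω => ψ fun i => X i ω) μ := by
  -- Vectors indexed by `A` are extended by the arbitrary value `0`; `DependsOn` makes the choice
  -- irrelevant.
  have hext : ∀ A : Finset ι, Measurable
      fun (x : A → ℝ) (i : ι) => if h : i ∈ A then x ⟨i, h⟩ else 0 := by
    intro A
    refine measurable_pi_lambda _ fun i => ?_
    by_cases h : i ∈ A
    · simpa [h] using measurable_pi_apply _
    · simp [h]
  have h := (hindep.indepFun_finset₀ S T hST hX).comp (hφ.comp (hext S)) (hψ.comp (hext T))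
  have e : ∀ (A : Finset ι) (χ : (ι → ℝ) → ℝ), DependsOn χ (A : Set ι) →
      (χ ∘ fun (x : A → ℝ) (i : ι) => if h : i ∈ A then x ⟨i, h⟩ else 0)
        ∘ (fun ω (i : A) => X i ω) = fun ω => χ fun i => X i ω := by
    intro A χ hχ
    ext ω
    refine hχ fun i hi => ?_
    have hi' : i ∈ A := hi
    simp [hi']
  rw [e S φ hφS, e T ψ hψT] at h
  exact h

variable [IsProbabilityMeasure μ]

/-- Expand around `c`: the cross term vanishes by independence. One centred factor is enough for
this, so only the mean of `X` is needed. -/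
lemma integral_half_sq_sub {X Y : Ω → ℝ} (hX : AEMeasurable X μ) (hY : AEMeasurable Y μ)
    (hXY : IndepFun X Y μ) (hXb : ∀ ω, X ω ∈ Set.Icc (0 : ℝ) 1)
    (hYb : ∀ ω, Y ω ∈ Set.Icc (0 : ℝ) 1) {c v : ℝ} (hXc : ∫ ω, X ω ∂μ = c)
    (hXv : ∫ ω, (X ω - c) ^ 2 ∂μ = v) (hYv : ∫ ω, (Y ω - c) ^ 2 ∂μ = v) :
    ∫ ω, (X ω - Y ω) ^ 2 / 2 ∂μ = v := by
  have sq_int : ∀ {W : Ω → ℝ}, AEMeasurable W μ → (∀ ω, W ω ∈ Set.Icc (0 : ℝ) 1) →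
      Integrable (fun ω => (W ω - c) ^ 2) μ := by
    intro W hW hWb
    refine integrable_of_bounded (a := 0) (b := (1 + |c|) ^ 2) ((hW.sub_const c).pow_const 2)
      fun ω => ⟨sq_nonneg _, ?_⟩
    rw [← sq_abs (W ω - c)]
    have h1 : |W ω - c| ≤ |W ω| + |c| := abs_sub _ _
    have h2 : |W ω| ≤ 1 := abs_le.2 ⟨by linarith [(hWb ω).1], (hWb ω).2⟩
    have := abs_nonneg (W ω - c)
    gcongr
    linarith
  have hXi := integrable_of_bounded hX hXb
  have hYi := integrable_of_bounded hY hYb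
  have hind : IndepFun (fun ω => X ω - c) (fun ω => Y ω - c) μ :=
    hXY.comp (measurable_id.sub_const c) (measurable_id.sub_const c)
  have hprod : ∫ ω, (X ω - c) * (Y ω - c) ∂μ = 0 := by
    have h := hind.integral_fun_mul_eq_mul_integral (hX.sub_const c).aestronglyMeasurable
      (hY.sub_const c).aestronglyMeasurable
    rw [h, integral_sub hXi (integrable_const _), hXc]
    simp
  have hpi : Integrable (fun ω => (X ω - c) * (Y ω - c)) μ :=
    hind.integrable_mul (hXi.sub (integrable_const c)) (hYi.sub (integrable_const c))
  have e : (fun ω => (X ω - Y ω) ^ 2 / 2)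
      = fun ω => 1 / 2 * ((X ω - c) ^ 2 + (Y ω - c) ^ 2) - (X ω - c) * (Y ω - c) := by
    ext ω
    ring
  have e1 : ∫ ω, (1 / 2 * ((X ω - c) ^ 2 + (Y ω - c) ^ 2) - (X ω - c) * (Y ω - c)) ∂μ
      = ∫ ω, 1 / 2 * ((X ω - c) ^ 2 + (Y ω - c) ^ 2) ∂μ - ∫ ω, (X ω - c) * (Y ω - c) ∂μ :=
    integral_sub (((sq_int hX hXb).add (sq_int hY hYb)).const_mul _) hpi
  rw [e, e1, integral_const_mul, integral_add (sq_int hX hXb) (sq_int hY hYb), hXv, hYv, hprod]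
  ring

lemma half_sq_sub_mem_Icc {x y : ℝ} (hx : x ∈ Set.Icc (0 : ℝ) 1) (hy : y ∈ Set.Icc (0 : ℝ) 1) :
    (x - y) ^ 2 / 2 ∈ Set.Icc (0 : ℝ) (1 / 2) :=
  ⟨by positivity, by nlinarith [hx.1, hx.2, hy.1, hy.2]⟩

/-- On `[0, 1/2]` one has `h² ≤ h/2`, so the quadratic bound on `exp (-s h)` becomes linear in `h`
and only the mean survives. -/
lemma mgf_neg_le_of_mem_Icc_half {H : Ω → ℝ} (hH : AEMeasurable H μ)
    (hb : ∀ ω, H ω ∈ Set.Icc (0 : ℝ) (1 / 2)) {s : ℝ} (hs : 0 ≤ s) :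
    mgf H μ (-s) ≤ Real.exp (-(s - s ^ 2 / 4) * ∫ ω, H ω ∂μ) := by
  have hHi := integrable_of_bounded hH hb
  have h1 : mgf H μ (-s) ≤ ∫ ω, (1 + -(s - s ^ 2 / 4) * H ω) ∂μ := by
    refine integral_mono (integrable_exp_mul_of_mem_Icc hH (Filter.Eventually.of_forall hb))
      ((integrable_const _).add (hHi.const_mul _)) fun ω => ?_
    have h := exp_neg_le_quadratic (mul_nonneg hs (hb ω).1)
    rw [← neg_mul] at h
    refine h.trans ?_
    have h2 : s ^ 2 * (H ω * (1 / 2 - H ω)) ≥ 0 :=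
      mul_nonneg (sq_nonneg s) (mul_nonneg (hb ω).1 (by linarith [(hb ω).2]))
    show 1 - s * H ω + (s * H ω) ^ 2 / 2 ≤ 1 + -(s - s ^ 2 / 4) * H ω
    nlinarith
  rw [integral_add (integrable_const _) (hHi.const_mul _), integral_const_mul] at h1
  refine h1.trans (le_trans (le_of_eq ?_) (Real.add_one_le_exp _))
  simp
  ring

/-- The moment generating function of a sum of `(x - y) ^ 2 / 2` over disjoint pairs of independent
variables in `[0, 1]`. -/
lemma mgf_sum_pairs_le {m k : ℕ} {X : Fin m → Ω → ℝ} (hX : ∀ i, AEMeasurable (X i) μ)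
    (hindep : iIndepFun X μ) (hb : ∀ i ω, X i ω ∈ Set.Icc (0 : ℝ) 1) {c v : ℝ}
    (hc : ∀ i, ∫ ω, X i ω ∂μ = c) (hv : ∀ i, ∫ ω, (X i ω - c) ^ 2 ∂μ = v)
    {p q : Fin k → Fin m} (hp : p.Injective) (hq : q.Injective) (hpq : ∀ i j, p i ≠ q j)
    {s : ℝ} (hs : 0 ≤ s) (A : Finset (Fin k)) :
    mgf (fun ω => ∑ i ∈ A, (X (p i) ω - X (q i) ω) ^ 2 / 2) μ (-s)
      ≤ Real.exp (-(s - s ^ 2 / 4) * v) ^ A.card := by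
  have hpair : ∀ i, AEMeasurable (fun ω => (X (p i) ω - X (q i) ω) ^ 2 / 2) μ := fun i =>
    (((hX _).sub (hX _)).pow_const 2).div_const 2
  induction A using Finset.induction_on with
  | empty => simp [mgf]
  | insert a A ha ih =>
    have hdisj : Disjoint ({p a, q a} : Finset (Fin m)) (A.image p ∪ A.image q) := by
      rw [Finset.disjoint_left]
      intro x hx hx'
      simp only [Finset.mem_insert, Finset.mem_singleton] at hx
      simp only [Finset.mem_union, Finset.mem_image] at hx'
      rcases hx with rfl | rfl <;> rcases hx' with ⟨i, hi, h⟩ | ⟨i, hi, h⟩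
      · exact ha (hp h ▸ hi)
      · exact hpq _ _ h.symm
      · exact hpq _ _ h
      · exact ha (hq h ▸ hi)
    have hI := indepFun_of_dependsOn hindep hX hdisj
      (φ := fun x => (x (p a) - x (q a)) ^ 2 / 2)
      (ψ := fun x => ∑ i ∈ A, (x (p i) - x (q i)) ^ 2 / 2)
      (by fun_prop) (by fun_prop)
      (by
        intro x y h
        have h1 := h (p a) (by simp)
        have h2 := h (q a) (by simp)
        simp only [h1, h2])
      (by
        intro x y h
        refine Finset.sum_congr rfl fun i hi => ?_
        have h1 := h (p i) (by
          simp only [Finset.coe_union, Finset.coe_image]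
          exact Or.inl ⟨i, hi, rfl⟩)
        have h2 := h (q i) (by
          simp only [Finset.coe_union, Finset.coe_image]
          exact Or.inr ⟨i, hi, rfl⟩)
        simp only [h1, h2])
    have hsm : AEMeasurable (fun ω => ∑ i ∈ A, (X (p i) ω - X (q i) ω) ^ 2 / 2) μ :=
      Finset.aemeasurable_fun_sum _ fun i _ => hpair i
    have e : (fun ω => ∑ i ∈ insert a A, (X (p i) ω - X (q i) ω) ^ 2 / 2)
        = (fun ω => (X (p a) ω - X (q a) ω) ^ 2 / 2)
          + fun ω => ∑ i ∈ A, (X (p i) ω - X (q i) ω) ^ 2 / 2 := by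
      ext ω
      rw [Finset.sum_insert ha]
      rfl
    rw [e, hI.mgf_add' (hpair a).aestronglyMeasurable hsm.aestronglyMeasurable,
      Finset.card_insert_of_notMem ha, pow_succ']
    refine mul_le_mul ?_ ih mgf_nonneg (Real.exp_pos _).le
    have h := mgf_neg_le_of_mem_Icc_half (hpair a)
      (fun ω => half_sq_sub_mem_Icc (hb (p a) ω) (hb (q a) ω)) hs
    rwa [integral_half_sq_sub (hX _) (hX _) (hindep.indepFun (hpq a a)) (hb _) (hb _) (hc _)
      (hv _) (hv _)] at h

/-- The lower tail of the sample variance of independent variables in `[0, 1]` with common mean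
and variance, by averaging over permutations of disjoint pairs. -/
lemma sampleVariance_lower_tail {m : ℕ} (hm : 1 < m) {X : Fin m → Ω → ℝ}
    (hX : ∀ i, AEMeasurable (X i) μ) (hindep : iIndepFun X μ)
    (hb : ∀ i ω, X i ω ∈ Set.Icc (0 : ℝ) 1) {c v : ℝ}
    (hc : ∀ i, ∫ ω, X i ω ∂μ = c) (hv : ∀ i, ∫ ω, (X i ω - c) ^ 2 ∂μ = v) (hv0 : 0 < v)
    {w : ℝ} (hw : 0 ≤ w) :
    μ.real {ω | w ≤ v - sampleVariance fun i => X i ω}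
      ≤ Real.exp (-((m - 1) * w ^ 2 / (2 * v))) := by
  -- For odd `m` one index stays unpaired; `2k ≥ m - 1` is the source of the factor `m - 1` in the
  -- tail bound.
  set k := m / 2 with hk
  have hkm : 2 * k ≤ m := by omega
  have hk1 : 1 ≤ k := by omega
  have hmk : (m : ℝ) - 1 ≤ 2 * k := by
    have : m ≤ 2 * k + 1 := by omega
    have : (m : ℝ) ≤ 2 * k + 1 := by exact_mod_cast this
    linarith
  let p : Fin k → Fin m := fun i => ⟨2 * i, by omega⟩
  let q : Fin k → Fin m := fun i => ⟨2 * i + 1, by omega⟩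
  have hp : p.Injective := fun i j h => Fin.ext (by simp only [p, Fin.mk.injEq] at h; omega)
  have hq : q.Injective := fun i j h => Fin.ext (by simp only [q, Fin.mk.injEq] at h; omega)
  have hpq : ∀ i j, p i ≠ q j := fun i j h => by simp only [p, q, Fin.mk.injEq] at h; omega
  -- This minimises the Chernoff exponent `k (-s w + s² v / 4)`, with minimum `-k w² / v`.
  set s : ℝ := 2 * w / v with hs
  have hs0 : 0 ≤ s := by positivity
  let S : Equiv.Perm (Fin m) → Ω → ℝ :=
    fun π ω => ∑ i : Fin k, (X (π (p i)) ω - X (π (q i)) ω) ^ 2 / 2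
  have hSm : ∀ π, AEMeasurable (S π) μ := fun π =>
    Finset.aemeasurable_fun_sum _ fun i _ => (((hX _).sub (hX _)).pow_const 2).div_const 2
  have hSb : ∀ π ω, S π ω ∈ Set.Icc (0 : ℝ) (∑ _ : Fin k, 1 / 2) := fun π ω =>
    ⟨Finset.sum_nonneg fun i _ => (half_sq_sub_mem_Icc (hb _ ω) (hb _ ω)).1,
      Finset.sum_le_sum fun i _ => (half_sq_sub_mem_Icc (hb _ ω) (hb _ ω)).2⟩
  have hSi : ∀ π, Integrable (fun ω => Real.exp (-s * S π ω)) μ := fun π =>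
    integrable_exp_mul_of_mem_Icc (hSm π) (Filter.Eventually.of_forall (hSb π))
  set N : ℝ := (Nat.factorial m : ℝ) with hN
  have hN0 : 0 < N := by positivity
  have hVS : ∀ ω, (k : ℝ) * sampleVariance (fun i => X i ω) = ∑ π, N⁻¹ * S π ω := by
    intro ω
    have h1 : ∀ i : Fin k, sampleVariance (fun i => X i ω) = N⁻¹ *
        ∑ π : Equiv.Perm (Fin m), (X (π (p i)) ω - X (π (q i)) ω) ^ 2 / 2 := fun i =>
      sampleVariance_eq_perm (fun i => X i ω) (hpq i i)
    have h2 : (k : ℝ) * sampleVariance (fun i => X i ω)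
        = ∑ _ : Fin k, sampleVariance (fun i => X i ω) := by simp
    rw [h2, Finset.sum_congr rfl fun i _ => h1 i, ← Finset.mul_sum, Finset.sum_comm,
      ← Finset.mul_sum]
  set T : Ω → ℝ := fun ω => (k : ℝ) * sampleVariance (fun i => X i ω) with hT
  have hTm : AEMeasurable T μ := by
    have : T = fun ω => ∑ π, N⁻¹ * S π ω := funext hVS
    rw [this]
    exact Finset.aemeasurable_fun_sum _ fun π _ => (hSm π).const_mul _
  have hw1 : ∑ _ : Equiv.Perm (Fin m), N⁻¹ = 1 := by
    rw [Finset.sum_const, Finset.card_univ, Fintype.card_perm, Fintype.card_fin, nsmul_eq_mul,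
      mul_inv_cancel₀ hN0.ne']
  -- Jensen: the sums `S π` for different `π` are dependent, but convexity requires only their
  -- individual moment generating functions.
  have hJ : ∀ ω, Real.exp (-s * T ω) ≤ ∑ π, N⁻¹ * Real.exp (-s * S π ω) := by
    intro ω
    have h := convexOn_exp.map_sum_le (t := Finset.univ) (w := fun _ : Equiv.Perm (Fin m) => N⁻¹)
      (p := fun π => -s * S π ω) (fun _ _ => by positivity) hw1 (fun _ _ => Set.mem_univ _)
    simp only [smul_eq_mul] at h
    refine le_trans (le_of_eq ?_) h
    rw [hT]
    simp only [hVS]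
    rw [Finset.mul_sum]
    congr 1
    exact Finset.sum_congr rfl fun π _ => by ring
  have hsumi : Integrable (fun ω => ∑ π, N⁻¹ * Real.exp (-s * S π ω)) μ :=
    integrable_finsetSum _ fun π _ => (hSi π).const_mul _
  have hTi : Integrable (fun ω => Real.exp (-s * T ω)) μ :=
    hsumi.mono' (hTm.const_mul _).exp.aestronglyMeasurable
      (Filter.Eventually.of_forall fun ω => by
        rw [Real.norm_eq_abs, abs_of_pos (Real.exp_pos _)]
        exact hJ ω)
  have hmgf : mgf T μ (-s) ≤ Real.exp (k * (-(s - s ^ 2 / 4) * v)) := by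
    calc mgf T μ (-s) ≤ ∫ ω, ∑ π, N⁻¹ * Real.exp (-s * S π ω) ∂μ :=
          integral_mono hTi hsumi hJ
      _ = ∑ π, N⁻¹ * mgf (S π) μ (-s) := by
          rw [integral_finsetSum _ fun π _ => (hSi π).const_mul _]
          exact Finset.sum_congr rfl fun π _ => integral_const_mul _ _
      _ ≤ ∑ _ : Equiv.Perm (Fin m), N⁻¹ * Real.exp (k * (-(s - s ^ 2 / 4) * v)) := by
          refine Finset.sum_le_sum fun π _ => mul_le_mul_of_nonneg_left ?_ (by positivity)
          have h := mgf_sum_pairs_le hX hindep hb hc hv (p := π ∘ p) (q := π ∘ q)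
            (π.injective.comp hp) (π.injective.comp hq)
            (fun i j h => hpq i j (π.injective h)) hs0 Finset.univ
          rw [Finset.card_univ, Fintype.card_fin, ← Real.exp_nat_mul] at h
          exact h
      _ = Real.exp (k * (-(s - s ^ 2 / 4) * v)) := by rw [← Finset.sum_mul, hw1, one_mul]
  have hch := measure_le_le_exp_mul_mgf (μ := μ) (X := T) (k * (v - w)) (neg_nonpos.2 hs0) hTi
  have hk0 : (0 : ℝ) < k := by exact_mod_cast hk1
  have hset : {ω | w ≤ v - sampleVariance fun i => X i ω} = {ω | T ω ≤ k * (v - w)} := by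
    ext ω
    simp only [Set.mem_ofPred_eq, hT]
    rw [mul_le_mul_iff_right₀ hk0]
    constructor <;> intro h <;> linarith
  rw [hset]
  refine hch.trans ((mul_le_mul_of_nonneg_left hmgf (Real.exp_pos _).le).trans ?_)
  rw [← Real.exp_add, Real.exp_le_exp]
  have e : - -s * (k * (v - w)) + k * (-(s - s ^ 2 / 4) * v) = -(2 * k * (w ^ 2 / (2 * v))) := by
    rw [hs]
    field_simp
    ring
  rw [e, mul_div_assoc]
  have : 0 ≤ w ^ 2 / (2 * v) := by positivity
  nlinarith [mul_le_mul_of_nonneg_right hmk this]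

end

/-! ### Empirical Bernstein and Hoeffding inequalities -/

/-- Otherwise `v - V = (√v - √V)(√v + √V)` would exceed `√(2L/r) * √v`. -/
lemma sqrt_le_sqrt_add_of_le {v V L r : ℝ} (hV : 0 ≤ V) (hL : 0 ≤ L) (hr : 0 < r) (hv : 0 ≤ v)
    (h : v - V ≤ √(2 * v * L / r)) : √v ≤ √V + √(2 * L / r) := by
  have e : √(2 * v * L / r) = √(2 * L / r) * √v := by
    rw [← Real.sqrt_mul (by positivity)]
    congr 1
    ring
  rw [e] at h
  by_contra! hlt
  have h1 := Real.sq_sqrt hv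
  have h2 := Real.sq_sqrt hV
  have h3 := Real.sqrt_nonneg V
  have h4 := Real.sqrt_nonneg (2 * L / r)
  nlinarith

section

variable {Ω : Type*} [MeasurableSpace Ω] {μ : Measure Ω} [IsProbabilityMeasure μ]

/-- The empirical Bernstein inequality for independent variables in `[0, 1]` with common mean and
variance. -/
lemma empirical_bernstein_unit {m : ℕ} (hm : 1 < m) {X : Fin m → Ω → ℝ}
    (hX : ∀ i, AEMeasurable (X i) μ) (hindep : iIndepFun X μ)
    (hb : ∀ i ω, X i ω ∈ Set.Icc (0 : ℝ) 1) {c v : ℝ}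
    (hc : ∀ i, ∫ ω, X i ω ∂μ = c) (hv : ∀ i, ∫ ω, (X i ω - c) ^ 2 ∂μ = v) {L : ℝ} (hL : 0 < L) :
    μ.real {ω | 1 / (m : ℝ) * ∑ i, X i ω + √(2 * sampleVariance (fun i => X i ω) * L / m)
        + 7 * L / (3 * ((m : ℝ) - 1)) < c} ≤ 2 * Real.exp (-L) := by
  have hm' : (1 : ℝ) < m := by exact_mod_cast hm
  have hm1 : (0 : ℝ) < m - 1 := by linarith
  have hm0 : (0 : ℝ) < m := by linarith
  have hv0 : 0 ≤ v := by
    rw [← hv ⟨0, by omega⟩]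
    exact integral_nonneg fun ω => sq_nonneg _
  have hle : L / m ≤ L / (m - 1) := div_le_div_of_nonneg_left hL.le hm1 (by linarith)
  have hLm : 0 < L / m := by positivity
  have e7 : 7 * L / (3 * ((m : ℝ) - 1)) = 7 / 3 * (L / (m - 1)) := by
    field_simp
  have e3 : L / (3 * (m : ℝ)) = 1 / 3 * (L / m) := by field_simp
  -- The optimal `a` divides by `v`. If `v = 0`, then `a = 1` already gives deviation `(4/3) L/m`.
  rcases hv0.eq_or_lt with h0 | hvpos
  · have h := bernstein_lower_tail (by omega) hX hindep hb hc hv (L := L) one_pos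
    refine (measureReal_mono ?_).trans (h.trans (by linarith [Real.exp_pos (-L)]))
    intro ω hω
    simp only [Set.mem_ofPred_eq] at hω ⊢
    have := Real.sqrt_nonneg (2 * sampleVariance (fun i => X i ω) * L / m)
    rw [← h0, e3]
    simp only [mul_one]
    rw [e7] at hω
    linarith
  -- This balances `v a / 2` and `L / (m a)`; their sum becomes `√(2L/m) * √v`.
  · set a : ℝ := √(2 * (L / m) / v) with ha
    have ha0 : 0 < a := Real.sqrt_pos.2 (by positivity)
    have hasq : a ^ 2 = 2 * (L / m) / v := Real.sq_sqrt (by positivity)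
    have hA := bernstein_lower_tail (by omega) hX hindep hb hc hv (L := L) ha0
    have hB := sampleVariance_lower_tail hm hX hindep hb hc hv hvpos
      (Real.sqrt_nonneg (2 * v * L / (m - 1)))
    have eB : ((m : ℝ) - 1) * √(2 * v * L / (m - 1)) ^ 2 / (2 * v) = L := by
      rw [Real.sq_sqrt (by positivity)]
      field_simp
    rw [eB] at hB
    have hu : v * a / 2 + L / (m * a) = √(2 * L / m) * √v := by
      have e1 : L / (m * a) = v * a / 2 := by
        have : v * a ^ 2 = 2 * (L / m) := by rw [hasq]; field_simp
        have hne := ha0.ne'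
        field_simp
        field_simp at this
        linarith
      rw [e1, add_halves, ← Real.sqrt_mul (by positivity)]
      refine ((Real.sqrt_eq_iff_mul_self_eq (by positivity) (by positivity)).2 ?_).symm
      rw [show v * a * (v * a) = v ^ 2 * a ^ 2 by ring, hasq]
      field_simp
    refine (measureReal_mono fun ω hω => ?_).trans ((measureReal_union_le _ _).trans
      ((add_le_add hA hB).trans_eq (two_mul _).symm))
    by_contra hn
    simp only [Set.mem_union, Set.mem_ofPred_eq, not_or, not_le] at hn hω
    obtain ⟨h1, h2⟩ := hn
    set V := sampleVariance fun i => X i ω with hV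
    have hVn : 0 ≤ V := sampleVariance_nonneg hm _
    have h3 := sqrt_le_sqrt_add_of_le hVn hL.le hm1 hv0 h2.le
    rw [hu, e3] at h1
    rw [e7] at hω
    have h4 : √(2 * V * L / m) = √(2 * L / m) * √V := by
      rw [← Real.sqrt_mul (by positivity)]
      congr 1
      ring
    -- Replacing `√v` by `√V` costs `2 L/(m-1)`; with the `L/(3m)` from Bernstein this gives the
    -- constant `7/3`.
    have h5 : √(2 * L / m) * √(2 * L / (m - 1)) ≤ 2 * (L / (m - 1)) := by
      have : √(2 * L / m) ≤ √(2 * L / (m - 1)) := by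
        apply Real.sqrt_le_sqrt
        rw [mul_div_assoc, mul_div_assoc]
        linarith
      calc _ ≤ √(2 * L / (m - 1)) * √(2 * L / (m - 1)) := by gcongr
        _ = 2 * (L / (m - 1)) := by
          rw [Real.mul_self_sqrt (by positivity), mul_div_assoc]
    have h6 := mul_le_mul_of_nonneg_left h3 (Real.sqrt_nonneg (2 * L / m))
    rw [h4] at hω
    linarith

/-- The empirical Bernstein inequality for independent variables in `[0, M]` with common mean and
second moment. -/
lemma empirical_bernstein {m : ℕ} (hm : 1 < m) {Z : Fin m → Ω → ℝ}
    (hZ : ∀ i, AEMeasurable (Z i) μ) (hindep : iIndepFun Z μ) {M : ℝ} (hM : 0 < M)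
    (hb : ∀ i ω, Z i ω ∈ Set.Icc (0 : ℝ) M) {c v : ℝ}
    (hc : ∀ i, ∫ ω, Z i ω ∂μ = c) (hv : ∀ i, ∫ ω, (Z i ω - c) ^ 2 ∂μ = v) {L : ℝ} (hL : 0 < L) :
    μ.real {ω | 1 / (m : ℝ) * ∑ i, Z i ω + √(2 * sampleVariance (fun i => Z i ω) * L / m)
        + 7 * M * L / (3 * ((m : ℝ) - 1)) < c} ≤ 2 * Real.exp (-L) := by
  have h := empirical_bernstein_unit hm (X := fun i ω => Z i ω / M) (c := c / M) (v := v / M ^ 2)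
    (fun i => (hZ i).div_const M) (hindep.comp (fun _ x => x / M) fun _ => measurable_id.div_const M)
    (fun i ω => ⟨div_nonneg (hb i ω).1 hM.le, (div_le_one hM).2 (hb i ω).2⟩)
    (fun i => by rw [integral_div, hc]) (fun i => by
      simp_rw [← sub_div, div_pow]
      rw [integral_div, hv]) hL
  refine le_trans (measureReal_mono fun ω hω => ?_) h
  simp only [Set.mem_ofPred_eq] at hω ⊢
  rw [lt_div_iff₀ hM, sampleVariance_div, ← Finset.sum_div]
  have e : √(2 * (sampleVariance (fun i => Z i ω) / M ^ 2) * L / m)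
      = √(2 * sampleVariance (fun i => Z i ω) * L / m) / M := by
    rw [show 2 * (sampleVariance (fun i => Z i ω) / M ^ 2) * L / m
      = 2 * sampleVariance (fun i => Z i ω) * L / m / M ^ 2 by ring,
      Real.sqrt_div' _ (sq_nonneg M), Real.sqrt_sq hM.le]
  rw [e]
  refine lt_of_eq_of_lt ?_ hω
  field_simp

/-- Hoeffding's inequality for the lower tail of the mean of independent variables in `[0, M]`. -/
lemma hoeffding_lower_tail {m : ℕ} (hm : 0 < m) {W : Fin m → Ω → ℝ}
    (hW : ∀ i, AEMeasurable (W i) μ) (hindep : iIndepFun W μ) {M : ℝ} (hM : 0 < M)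
    (hb : ∀ i ω, W i ω ∈ Set.Icc (0 : ℝ) M) {c : ℝ}
    (hc : ∀ i, ∫ ω, W i ω ∂μ = c) {L : ℝ} (hL : 0 ≤ L) :
    μ.real {ω | 1 / (m : ℝ) * ∑ i, W i ω + M * √(L / (2 * m)) < c} ≤ Real.exp (-L) := by
  have hm0 : (0 : ℝ) < m := by exact_mod_cast hm
  have hsub : ∀ i, HasSubgaussianMGF (fun ω => c - W i ω) ((‖(0 : ℝ) - (-M)‖₊ / 2) ^ 2) μ := by
    intro i
    have h := hasSubgaussianMGF_of_mem_Icc (μ := μ) (X := fun ω => -W i ω) (a := -M) (b := 0)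
      (hW i).neg (Filter.Eventually.of_forall fun ω =>
        ⟨neg_le_neg (hb i ω).2, neg_nonpos.2 (hb i ω).1⟩)
    rw [integral_neg, hc i] at h
    convert! h using 2
    ring
  have hind : iIndepFun (fun i ω => c - W i ω) μ :=
    hindep.comp (fun _ x => c - x) fun _ => measurable_const.sub measurable_id
  have h := HasSubgaussianMGF.measure_sum_ge_le_of_iIndepFun hind (s := Finset.univ)
    (fun i _ => hsub i) (ε := m * (M * √(L / (2 * m)))) (by positivity)
  refine (measureReal_mono fun ω hω => ?_).trans (h.trans (le_of_eq ?_))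
  · simp only [Set.mem_ofPred_eq, Finset.sum_sub_distrib, Finset.sum_const, Finset.card_univ,
      Fintype.card_fin, nsmul_eq_mul] at hω ⊢
    have e : ∑ i, W i ω = m * (1 / (m : ℝ) * ∑ i, W i ω) := by field_simp
    rw [e, ← mul_sub]
    exact mul_le_mul_of_nonneg_left (by linarith) hm0.le
  · congr 1
    have hs := Real.sq_sqrt (show 0 ≤ L / (2 * m) by positivity)
    simp only [Finset.sum_const, Finset.card_univ, Fintype.card_fin, NNReal.coe_pow,
      NNReal.coe_div, coe_nnnorm, zero_sub, neg_neg, nsmul_eq_mul, NNReal.coe_mul,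
      NNReal.coe_natCast, NNReal.coe_ofNat, Real.norm_of_nonneg hM.le]
    rw [mul_pow, mul_pow, hs]
    field_simp

end

/-! ### The clipped estimator and its bias -/

section

variable {Query G : Type*} [MeasurableSpace Query] {n : ℕ}
  {obs : Kernel (Query × (Fin n → Bool)) (Fin n → Bool)}
  {σ : Query → G → ℕ → Fin n} {g : G} {k t : ℕ} {lam : ℝ}

lemma bit_nonneg (b : Bool) : 0 ≤ bit b := by cases b <;> simp [bit]

lemma bit_le_one (b : Bool) : bit b ≤ 1 := by cases b <;> simp [bit]

lemma measurable_bit : Measurable bit := measurable_of_countable _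

lemma propensity_nonneg (q : Query) (r : Fin n → Bool) (j : Fin n) : 0 ≤ propensity obs q r j :=
  measureReal_nonneg

lemma measurable_ranked_coordinate (hσ : Measurable fun q => σ q g k) :
    Measurable fun x : Query × (Fin n → Bool) => bit (x.2 (σ x.1 g k)) := by
  have h : Measurable fun y : (Fin n → Bool) × Fin n => bit (y.1 y.2) :=
    measurable_from_prod_countable_left fun j => measurable_bit.comp (measurable_pi_apply j)
  exact h.comp (measurable_snd.prodMk (hσ.comp measurable_fst))

lemma measurableSet_observed (j : Fin n) : MeasurableSet {o : Fin n → Bool | o j = true} :=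
  measurableSet_eq_fun (measurable_pi_apply j) measurable_const

lemma measurable_ranked_propensity (hσ : Measurable fun q => σ q g k) :
    Measurable fun z : Query × (Fin n → Bool) => propensity obs z.1 z.2 (σ z.1 g k) := by
  have h : Measurable fun y : (Query × (Fin n → Bool)) × Fin n =>
      propensity obs y.1.1 y.1.2 y.2 :=
    measurable_from_prod_countable_left fun j =>
      (obs.measurable_coe (measurableSet_observed j)).ennreal_toReal
  exact h.comp (measurable_id.prodMk (hσ.comp measurable_fst))

lemma measurable_requestCIPW (hσ : ∀ k ∈ Finset.Icc 1 t, Measurable fun q => σ q g k) :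
    Measurable fun x : (Query × (Fin n → Bool)) × (Fin n → Bool) =>
      requestCIPW obs σ lam g t x.1.1 x.1.2 x.2 := by
  unfold requestCIPW feedback
  refine Finset.measurable_sum _ fun k hk => ?_
  have hfst : Measurable fun x : (Query × (Fin n → Bool)) × (Fin n → Bool) => x.1 :=
    measurable_fst
  have h1 := (measurable_ranked_propensity (obs := obs) (hσ k hk)).comp hfst
  have h2 := (measurable_ranked_coordinate (hσ k hk)).comp hfst
  have h3 := (measurable_ranked_coordinate (hσ k hk)).comp
    ((measurable_fst.comp measurable_fst).prodMk measurable_snd :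
      Measurable fun x : (Query × (Fin n → Bool)) × (Fin n → Bool) => (x.1.1, x.2))
  exact (measurable_const.min (measurable_const.div h1)).mul (h3.mul h2)

lemma requestCIPW_mem_Icc (hlam : 0 ≤ lam) (q : Query) (r o : Fin n → Bool) :
    requestCIPW obs σ lam g t q r o ∈ Set.Icc 0 (t * lam) := by
  have hmin : ∀ j, 0 ≤ min lam (1 / propensity obs q r j) := fun j =>
    le_min hlam (one_div_nonneg.2 (propensity_nonneg _ _ _))
  have hfb : ∀ j, 0 ≤ feedback r o j := fun j => mul_nonneg (bit_nonneg _) (bit_nonneg _)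
  refine ⟨Finset.sum_nonneg fun k _ => mul_nonneg (hmin _) (hfb _), ?_⟩
  have : ∀ k ∈ Finset.Icc 1 t,
      min lam (1 / propensity obs q r (σ q g k)) * feedback r o (σ q g k) ≤ lam := by
    intro k _
    calc _ ≤ lam * 1 := mul_le_mul (min_le_left _ _)
          (mul_le_one₀ (bit_le_one _) (bit_nonneg _) (bit_le_one _)) (hfb _) hlam
      _ = lam := mul_one _
  refine (Finset.sum_le_card_nsmul _ _ _ this).trans (le_of_eq ?_)
  simp

variable (obs σ g t lam) in
/-- The bias term that one request contributes to the upper confidence bound. -/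
noncomputable def clippingBias (z : Query × (Fin n → Bool)) : ℝ :=
  ∑ k ∈ Finset.Icc 1 t, max 0 (1 - lam * propensity obs z.1 z.2 (σ z.1 g k))

lemma measurable_clippingBias (hσ : ∀ k ∈ Finset.Icc 1 t, Measurable fun q => σ q g k) :
    Measurable (clippingBias obs σ g t lam) := by
  unfold clippingBias
  exact Finset.measurable_sum _ fun k hk => measurable_const.max
    (measurable_const.sub ((measurable_ranked_propensity (hσ k hk)).const_mul lam))

lemma clippingBias_mem_Icc (hlam : 0 ≤ lam) (z : Query × (Fin n → Bool)) :
    clippingBias obs σ g t lam z ∈ Set.Icc (0 : ℝ) t := by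
  refine ⟨Finset.sum_nonneg fun k _ => le_max_left _ _, ?_⟩
  refine (Finset.sum_le_card_nsmul _ _ 1 fun k _ => max_le zero_le_one ?_).trans (le_of_eq ?_)
  · linarith [mul_nonneg hlam (propensity_nonneg (obs := obs) z.1 z.2 (σ z.1 g k))]
  · simp

lemma integral_bit_observed (z : Query × (Fin n → Bool)) (j : Fin n) :
    ∫ o, bit (o j) ∂(obs z) = propensity obs z.1 z.2 j := by
  have e : (fun o : Fin n → Bool => bit (o j)) = {o | o j = true}.indicator 1 := by
    ext o
    by_cases h : o j = true <;> simp [bit, h]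
  rw [e, integral_indicator_one (measurableSet_observed j)]
  rfl

variable [IsMarkovKernel obs]

lemma integral_requestCIPW_observed (q : Query) (r : Fin n → Bool) :
    ∫ o, requestCIPW obs σ lam g t q r o ∂(obs (q, r))
      = ∑ k ∈ Finset.Icc 1 t, min lam (1 / propensity obs q r (σ q g k))
          * (propensity obs q r (σ q g k) * bit (r (σ q g k))) := by
  unfold requestCIPW feedback
  rw [integral_finsetSum _ fun k _ => Integrable.of_finite]
  refine Finset.sum_congr rfl fun k _ => ?_
  rw [integral_const_mul, integral_mul_const, integral_bit_observed]

/-- For a relevant item this is the equality `min (λp) 1 + max 0 (1 - λp) = 1`; for an irrelevant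
one only the nonnegative bias remains. -/
lemma bit_le_clipped_add (lam : ℝ) {p : ℝ} (hp : 0 < p) (b : Bool) :
    bit b ≤ min lam (1 / p) * (p * bit b) + max 0 (1 - lam * p) := by
  cases b
  · simp [bit]
  · simp only [bit, if_true, mul_one]
    rcases min_choice lam (1 / p) with h | h
    · rw [h]
      linarith [le_max_right 0 (1 - lam * p)]
    · rw [h, one_div_mul_cancel hp.ne']
      linarith [le_max_left 0 (1 - lam * p)]

/-- The expected number of relevant items exceeds the expectation of the clipped estimate by at
most the expected clipping bias. -/
lemma expectedRelevant_le {P : Measure (Query × (Fin n → Bool))} [IsProbabilityMeasure P]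
    (hlam : 0 ≤ lam) (hσ : ∀ k ∈ Finset.Icc 1 t, Measurable fun q => σ q g k)
    (hpos : ∀ k ∈ Finset.Icc 1 t, ∀ᵐ z ∂P, 0 < propensity obs z.1 z.2 (σ z.1 g k)) :
    expectedRelevant P σ g t
      ≤ ∫ x, requestCIPW obs σ lam g t x.1.1 x.1.2 x.2 ∂(P ⊗ₘ obs)
        + ∫ z, clippingBias obs σ g t lam z ∂P := by
  have hF : Integrable (fun x : (Query × (Fin n → Bool)) × (Fin n → Bool) =>
      requestCIPW obs σ lam g t x.1.1 x.1.2 x.2) (P ⊗ₘ obs) :=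
    integrable_of_bounded (measurable_requestCIPW hσ).aemeasurable
      fun x => requestCIPW_mem_Icc hlam _ _ _
  have hB : Integrable (clippingBias obs σ g t lam) P :=
    integrable_of_bounded (measurable_clippingBias hσ).aemeasurable (clippingBias_mem_Icc hlam)
  have hI : Integrable (fun z : Query × (Fin n → Bool) =>
      ∫ o, requestCIPW obs σ lam g t z.1 z.2 o ∂(obs z)) P := by
    refine ((Measure.integrable_compProd_iff hF.aestronglyMeasurable).1 hF).2.congr
      (Filter.Eventually.of_forall fun z => integral_congr_ae (Filter.Eventually.of_forall
        fun o => Real.norm_of_nonneg (requestCIPW_mem_Icc hlam _ _ _).1))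
  rw [Measure.integral_compProd hF, ← integral_add hI hB]
  refine integral_mono_ae ?_ (hI.add hB) ?_
  · refine integrable_finsetSum _ fun k hk => ?_
    exact integrable_of_bounded (measurable_ranked_coordinate (hσ k hk)).aemeasurable
      fun z => ⟨bit_nonneg _, bit_le_one _⟩
  · have hall : ∀ᵐ z ∂P, ∀ k ∈ Finset.Icc 1 t, 0 < propensity obs z.1 z.2 (σ z.1 g k) :=
      (ae_ball_iff (Finset.countable_toSet _)).2 hpos
    filter_upwards [hall] with z hz
    rw [show obs z = obs (z.1, z.2) from rfl, integral_requestCIPW_observed, clippingBias,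
      ← Finset.sum_add_distrib]
    exact Finset.sum_le_sum fun k hk => bit_le_clipped_add lam (hz k hk) _

end

end FairFirstStage

/-! ### Combining the two tail bounds -/

theorem proposition4
    {Query D G Ω : Type*} [MeasurableSpace Query] [MeasurableSpace Ω]
    -- the items, the relevance model, the groups and the rankings
    {n : ℕ} (d : Fin n → D) (f : Query → D → unitInterval)
    (group : G → Finset (Fin n)) (tmax : G → ℕ) (htmax : ∀ g, tmax g ≤ (group g).card)
    (σ : Query → G → ℕ → Fin n) (hσ : FairFirstStage.IsGroupRanking d f group σ)
    (hσ_meas : ∀ g, ∀ k ∈ Finset.Icc 1 (tmax g), Measurable fun q => σ q g k)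
    -- the law of (query, relevance vector) and the law of the observation vector given these
    (P : Measure (Query × (Fin n → Bool))) [IsProbabilityMeasure P]
    (obs : Kernel (Query × (Fin n → Bool)) (Fin n → Bool)) [IsMarkovKernel obs]
    -- the `m` logged requests: independent, each with the joint law of query, relevance
    -- vector and observation vector
    (μ : Measure Ω) [IsProbabilityMeasure μ] (m : ℕ) (hm : 1 < m)
    (Q : Fin m → Ω → Query) (R O : Fin m → Ω → Fin n → Bool)
    (hlaw : ∀ i, HasLaw (fun ω => ((Q i ω, R i ω), O i ω)) (P ⊗ₘ obs) μ)
    (hindep : iIndepFun (fun i ω => ((Q i ω, R i ω), O i ω)) μ)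
    -- the propensities are positive, uniformly
    (hpos : ∃ γ : ℝ, 0 < γ ∧ ∀ g, ∀ k ∈ Finset.Icc 1 (tmax g),
      ∀ᵐ z ∂P, γ < FairFirstStage.propensity obs z.1 z.2 (σ z.1 g k))
    (lam : ℝ) (hlam : 0 < lam) (g : G) (t : ℕ) (ht : t ∈ Finset.Icc 1 (tmax g - 1))
    (α : ℝ) (hα : α ∈ Set.Ioo (0 : ℝ) 1) :
    1 - α ≤ μ.real {ω | FairFirstStage.expectedRelevant P σ g t ≤
      FairFirstStage.upperBound obs σ lam g t α
        (fun i => Q i ω) (fun i => R i ω) (fun i => O i ω)} := by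
  have htI : 1 ≤ t ∧ t ≤ tmax g - 1 := Finset.mem_Icc.1 ht
  have hsub : ∀ k ∈ Finset.Icc 1 t, k ∈ Finset.Icc 1 (tmax g) := fun k hk => by
    rw [Finset.mem_Icc] at hk ⊢
    omega
  have hσt : ∀ k ∈ Finset.Icc 1 t, Measurable fun q => σ q g k := fun k hk =>
    hσ_meas g k (hsub k hk)
  obtain ⟨γ, hγ, hγp⟩ := hpos
  have ht0 : (0 : ℝ) < t := by exact_mod_cast htI.1
  have hbias := FairFirstStage.expectedRelevant_le (P := P) (obs := obs) hlam.le hσt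
    fun k hk => (hγp g k (hsub k hk)).mono fun z hz => hγ.trans hz
  let F : (Query × (Fin n → Bool)) × (Fin n → Bool) → ℝ := fun x =>
    FairFirstStage.requestCIPW obs σ lam g t x.1.1 x.1.2 x.2
  let B : (Query × (Fin n → Bool)) × (Fin n → Bool) → ℝ := fun x =>
    FairFirstStage.clippingBias obs σ g t lam x.1
  have hF : Measurable F := FairFirstStage.measurable_requestCIPW hσt
  have hB : Measurable B := (FairFirstStage.measurable_clippingBias hσt).comp measurable_fst
  have hBint : ∫ x, B x ∂(P ⊗ₘ obs) = ∫ z, FairFirstStage.clippingBias obs σ g t lam z ∂P := by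
    rw [Measure.integral_compProd (FairFirstStage.integrable_of_bounded hB.aemeasurable
      fun x => FairFirstStage.clippingBias_mem_Icc hlam.le x.1)]
    simp [B]
  have hint : ∀ (H : (Query × (Fin n → Bool)) × (Fin n → Bool) → ℝ), Measurable H → ∀ i,
      ∫ ω, H ((Q i ω, R i ω), O i ω) ∂μ = ∫ x, H x ∂(P ⊗ₘ obs) := fun H hH i =>
    (hlaw i).integral_comp hH.aestronglyMeasurable
  have hα0 := hα.1
  have hα1 := hα.2
  have hL4 : 0 < Real.log (4 / α) := Real.log_pos (by rw [lt_div_iff₀ hα0]; linarith)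
  have hL2 : 0 < Real.log (2 / α) := Real.log_pos (by rw [lt_div_iff₀ hα0]; linarith)
  have hbern := FairFirstStage.empirical_bernstein hm
    (Z := fun i ω => F ((Q i ω, R i ω), O i ω)) (M := t * lam)
    (fun i => hF.comp_aemeasurable (hlaw i).aemeasurable)
    (hindep.comp (fun _ => F) fun _ => hF) (mul_pos ht0 hlam)
    (fun i ω => FairFirstStage.requestCIPW_mem_Icc hlam.le _ _ _)
    (hint F hF) (hint (fun x => (F x - ∫ x, F x ∂(P ⊗ₘ obs)) ^ 2)
      ((hF.sub_const _).pow_const 2)) hL4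
  have hhoef := FairFirstStage.hoeffding_lower_tail (by omega : 0 < m)
    (W := fun i ω => B ((Q i ω, R i ω), O i ω)) (M := t)
    (fun i => hB.comp_aemeasurable (hlaw i).aemeasurable)
    (hindep.comp (fun _ => B) fun _ => hB) ht0
    (fun i ω => FairFirstStage.clippingBias_mem_Icc hlam.le _) (hint B hB) hL2.le
  -- The failure probabilities become `2 * (α/4)` and `α/2`, with sum `α`.
  rw [Real.exp_neg, Real.exp_log (by positivity), inv_div] at hbern hhoef
  set good := {ω | FairFirstStage.expectedRelevant P σ g t ≤
    FairFirstStage.upperBound obs σ lam g t α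
      (fun i => Q i ω) (fun i => R i ω) (fun i => O i ω)} with hgood
  have hbad : μ.real goodᶜ ≤ α := by
    refine (measureReal_mono ?_).trans ((measureReal_union_le _ _).trans
      ((add_le_add hbern hhoef).trans (by linarith)))
    intro ω hω
    by_contra hn
    simp only [Set.mem_union, Set.mem_ofPred_eq, not_or, not_lt] at hn
    obtain ⟨h1, h2⟩ := hn
    refine hω ?_
    rw [hgood, Set.mem_ofPred_eq]
    refine hbias.trans ((add_le_add h1 (hBint ▸ h2)).trans (le_of_eq ?_))
    simp only [FairFirstStage.upperBound, FairFirstStage.cipw, F, B,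
      FairFirstStage.clippingBias, mul_assoc]
    ring
  -- Subadditivity suffices here, so measurability of `good` need not be established.
  have huniv : (1 : ℝ) ≤ μ.real good + μ.real goodᶜ := by
    have h := measureReal_union_le (μ := μ) good goodᶜ
    rwa [Set.union_compl_self, probReal_univ] at h
  linarith
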